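/- Let $G$ be a finite group with identity $e$, let $N_1,\dots,N_k$ be normal subgroups of $G$, and let $A=A(N_1,\dots,N_k)$ be the smallest family of normal subgroups of $G$ that contains $\{e\}$, $G$ and $N_1,\dots,N_k$ and is closed under products $HK=\{hk: h\in H,\ k\in K\}$ and intersections. For $N\in A$ put $$N^\circ = N\setminus \bigcup_{K\in A,\ K<N} K ,$$ where $K<N$ means that $K$ is properly contained in $N$. Then $$\mathcal K=\{N^\circ : N\in A,\ N^\circ\neq\emptyset\}$$ is the set of superclasses of a supercharacter theory of $G$. That is, $\mathcal K$ is a partition of $G$ with $\{e\}\in\mathcal K$, and there is a partition $\mathcal X$ of the set $\mathrm{Irr}(G)$ of irreducible complex characters of $G$ such that $|\mathcal X|=|\mathcal K|$ and for each $X\in\mathcal X$ there is a nonzero character $\chi_X$ of $G$, all of whose irreducible constituents lie in $X$, that is constant on every member of $\mathcal K$. -/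

import Mathlib

open scoped Pointwise

namespace SuperChar

/-- `ψ` is the character of a finite-dimensional complex representation of `G`
(the zero-dimensional one is allowed, so that the zero function is included). -/
def IsCharacter {G : Type*} [Group G] (ψ : G → ℂ) : Prop :=
  ∃ (n : ℕ) (ρ : Representation ℂ G (Fin n → ℂ)), ψ = ρ.character

/-- The set `Irr(G)` of irreducible complex characters of `G`. -/
def Irr (G : Type*) [Group G] : Set (G → ℂ) :=
  {χ | ∃ (n : ℕ) (ρ : Representation ℂ G (Fin n → ℂ)), ρ.IsIrreducible ∧ χ = ρ.character}

/-- The irreducible character `χ` is a constituent of `ψ`: `ψ - χ` is a character or zero. -/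
def IsConstituent {G : Type*} [Group G] (χ : Irr G) (ψ : G → ℂ) : Prop :=
  ∃ θ : G → ℂ, IsCharacter θ ∧ ψ = (χ : G → ℂ) + θ

/-- `(𝒳, 𝒦)` is a supercharacter theory of `G`. -/
structure IsSupercharacterTheory {G : Type*} [Group G]
    (𝒳 : Set (Set (Irr G))) (𝒦 : Set (Set G)) : Prop where
  partition_irr : Setoid.IsPartition 𝒳
  partition_group : Setoid.IsPartition 𝒦
  card_eq : 𝒦.encard = 𝒳.encard
  exists_supercharacter : ∀ X ∈ 𝒳, ∃ ψ : G → ℂ, IsCharacter ψ ∧ ψ ≠ 0 ∧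
    (∀ χ : Irr G, IsConstituent χ ψ → χ ∈ X) ∧
    ∀ C ∈ 𝒦, ∀ g ∈ C, ∀ h ∈ C, ψ g = ψ h
  one_mem : ({1} : Set G) ∈ 𝒦

/-- `𝒦` is the set of superclasses of some supercharacter theory of `G`. -/
def IsSuperclassTheory {G : Type*} [Group G] (𝒦 : Set (Set G)) : Prop :=
  ∃ 𝒳 : Set (Set (Irr G)), IsSupercharacterTheory 𝒳 𝒦

/-- Membership in the smallest family of subgroups that contains `S`, the trivial subgroup and `G`
and is closed under products `H * K = {h * k | h ∈ H, k ∈ K}` and intersections.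
The product `H * K` is a subgroup whenever `H` and `K` are normal. -/
inductive GeneratedFamily {G : Type*} [Group G] (S : Set (Subgroup G)) : Subgroup G → Prop
  | bot : GeneratedFamily S ⊥
  | top : GeneratedFamily S ⊤
  | of (H : Subgroup G) : H ∈ S → GeneratedFamily S H
  | mul (H K L : Subgroup G) : GeneratedFamily S H → GeneratedFamily S K →
      (L : Set G) = (H : Set G) * (K : Set G) → GeneratedFamily S L
  | inter (H K : Subgroup G) : GeneratedFamily S H → GeneratedFamily S K →
      GeneratedFamily S (H ⊓ K)

/-- The family `A(N₁, …, N_k)`. -/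
def familyA {G : Type*} [Group G] {k : ℕ} (N : Fin k → Subgroup G) : Set (Subgroup G) :=
  {H | GeneratedFamily (Set.range N) H}

/-- `H° = H \ ⋃ {K ∈ 𝒜 : K < H}`. -/
def circ {G : Type*} [Group G] (𝒜 : Set (Subgroup G)) (H : Subgroup G) : Set G :=
  (H : Set G) \ ⋃ K ∈ {K : Subgroup G | K ∈ 𝒜 ∧ K < H}, (K : Set G)

end SuperChar

/-!
For a normal subgroup `H` the average `e_H = |H|⁻¹ ∑_{h ∈ H} h` is a central idempotent of the group
algebra, and `e_H e_K = e_{HK}`. Hence the elements `f_H = e_H ∏_{K > H} (1 - e_K)`, for `H` in the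
family `A`, are central orthogonal idempotents with sum `1`. They sort the irreducible characters
into blocks, and the character `g ↦ |G| f_H(g⁻¹)` of the ideal `f_H ℂ[G]` has its constituents in
the block of `f_H`. It is constant on every `K°` because `f_H` is a linear combination of the `e_L`.

The same construction with the order of `A` reversed, applied to the indicator functions `1_H`,
which satisfy `1_H 1_K = 1_{H ∩ K}`, produces the indicator function of `H°`. The nonzero `f_H` form
a basis of the span of the `e_H` and the nonzero `1_{H°}` a basis of the span of the `1_H`. As `e_H`
is a multiple of `1_H`, these spans coincide, so there are as many blocks as classes, although for a
given `H` it may happen that only one of `f_H = 0` and `H° = ∅` holds.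
-/

namespace SuperChar

section StrictPart

theorem isIdempotentElem_of_map_sup {L R : Type*} [SemilatticeSup L] [Mul R] {e : L → R}
    (he : ∀ a b, e (a ⊔ b) = e a * e b) (a : L) : IsIdempotentElem (e a) := by
  rw [IsIdempotentElem, ← he, sup_idem]

variable {L R : Type*} [Fintype L] [CommRing R]

open Classical in
/-- The product `e a * ∏ (1 - e b)` over all `b > a`: what remains of `e a` after the `e b` with
`b > a` have been removed. It is used for `e` turning joins into products of idempotents. -/
noncomputable def strictPart [Preorder L] (e : L → R) (a : L) : R :=
  e a * ∏ b with a < b, (1 - e b)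

variable [SemilatticeSup L] {e : L → R}

theorem mul_strictPart_of_le (he : ∀ a b, e (a ⊔ b) = e a * e b) {a b : L} (hba : b ≤ a) :
    e b * strictPart e a = strictPart e a := by
  rw [strictPart, ← mul_assoc, ← he, sup_eq_right.mpr hba]

theorem mul_strictPart_of_not_le (he : ∀ a b, e (a ⊔ b) = e a * e b) {a b : L} (hba : ¬ b ≤ a) :
    e b * strictPart e a = 0 := by
  classical
  have hlt : b ⊔ a ∈ Finset.univ.filter (a < ·) := by simpa using hba
  rw [strictPart, ← mul_assoc, ← he, ← Finset.mul_prod_erase _ _ hlt, ← mul_assoc,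
    (isIdempotentElem_of_map_sup he _).mul_one_sub_self, zero_mul]

theorem isIdempotentElem_strictPart (he : ∀ a b, e (a ⊔ b) = e a * e b) (a : L) :
    IsIdempotentElem (strictPart e a) :=
  (isIdempotentElem_of_map_sup he a).mul <|
    Finset.prod_induction _ IsIdempotentElem (fun _ _ => .mul) .one
      fun b _ => (isIdempotentElem_of_map_sup he b).one_sub

theorem orthogonalIdempotents_strictPart (he : ∀ a b, e (a ⊔ b) = e a * e b) :
    OrthogonalIdempotents (strictPart e) where
  idem := isIdempotentElem_strictPart he
  ortho a b hab := by
    have absorb (c : L) : e c * strictPart e c = strictPart e c := mul_strictPart_of_le he le_rfl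
    dsimp only
    by_cases hle : a ≤ b
    · have hnle : ¬ b ≤ a := fun hba => hab (hle.antisymm hba)
      rw [← absorb b, mul_left_comm, ← mul_assoc, mul_strictPart_of_not_le he hnle, zero_mul]
    · rw [← absorb a, mul_right_comm, mul_strictPart_of_not_le he hle, zero_mul]

theorem mul_eq_zero_of_forall_strictPart_mul_eq_zero {x : R} (hx : ∀ a, strictPart e a * x = 0)
    (a : L) : e a * x = 0 := by
  classical
  induction a using WellFoundedGT.induction with
  | ind a ih =>
    have fixed : (∏ b with a < b, (1 - e b)) * x = x :=
      Finset.prod_induction _ (· * x = x) (fun y z hy hz => by rw [mul_assoc, hz, hy])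
        (one_mul x) fun b hb => by
          rw [sub_mul, one_mul, ih b (Finset.mem_filter.mp hb).2, sub_zero]
    rw [← fixed, ← mul_assoc]
    exact hx a

theorem completeOrthogonalIdempotents_strictPart (he : ∀ a b, e (a ⊔ b) = e a * e b)
    (hone : 1 ∈ Set.range e) : CompleteOrthogonalIdempotents (strictPart e) where
  toOrthogonalIdempotents := orthogonalIdempotents_strictPart he
  complete := by
    obtain ⟨a, ha⟩ := hone
    have horth := orthogonalIdempotents_strictPart he
    have hzero : e a * (1 - ∑ b, strictPart e b) = 0 :=
      mul_eq_zero_of_forall_strictPart_mul_eq_zero (fun b => by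
        rw [mul_sub, mul_one, horth.mul_sum_of_mem (Finset.mem_univ b), sub_self]) a
    rw [ha, one_mul, sub_eq_zero] at hzero
    exact hzero.symm

theorem span_range_strictPart (k : Type*) [CommRing k] [Algebra k R]
    (he : ∀ a b, e (a ⊔ b) = e a * e b) (hone : 1 ∈ Set.range e) :
    Submodule.span k (Set.range (strictPart e)) = Submodule.span k (Set.range e) := by
  classical
  apply le_antisymm <;> rw [Submodule.span_le]
  · let M : Submonoid R :=
      { carrier := Set.range e
        one_mem' := hone
        mul_mem' := by
          rintro _ _ ⟨a, rfl⟩ ⟨b, rfl⟩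
          exact ⟨a ⊔ b, he a b⟩ }
    have hadjoin : Subalgebra.toSubmodule (Algebra.adjoin k (Set.range e)) =
        Submodule.span k (Set.range e) := by
      rw [Algebra.adjoin_eq_span, show Submonoid.closure (Set.range e) = M from M.closure_eq]
      rfl
    have hmem (a : L) : e a ∈ Algebra.adjoin k (Set.range e) :=
      Algebra.subset_adjoin (Set.mem_range_self a)
    rintro _ ⟨a, rfl⟩
    rw [SetLike.mem_coe, ← hadjoin, Subalgebra.mem_toSubmodule]
    exact mul_mem (hmem a) (prod_mem fun b _ => sub_mem (one_mem _) (hmem b))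
  · rintro _ ⟨a, rfl⟩
    rw [SetLike.mem_coe, ← mul_one (e a),
      ← (completeOrthogonalIdempotents_strictPart he hone).complete, Finset.mul_sum]
    refine Submodule.sum_mem _ fun b _ => ?_
    by_cases hab : a ≤ b
    · rw [mul_strictPart_of_le he hab]
      exact Submodule.subset_span (Set.mem_range_self b)
    · rw [mul_strictPart_of_not_le he hab]
      exact Submodule.zero_mem _

end StrictPart

theorem linearIndependent_ne_zero_of_orthogonalIdempotents {ι k A : Type*} [Field k] [Ring A]
    [Algebra k A] {f : ι → A} (hf : OrthogonalIdempotents f) :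
    LinearIndependent k fun i : {i | f i ≠ 0} => f i := by
  rw [linearIndependent_iff']
  intro s c hc i hi
  have h := congrArg (f i * ·) hc
  simp only [mul_zero, Finset.mul_sum, mul_smul_comm] at h
  rw [Finset.sum_eq_single_of_mem i hi fun j _ hj => by
    rw [hf.ortho (Subtype.coe_ne_coe.mpr hj.symm), smul_zero], (hf.idem i).eq] at h
  exact (smul_eq_zero.mp h).resolve_right i.2

theorem finrank_span_range_of_orthogonalIdempotents {ι k A : Type*} [Finite ι] [Field k] [Ring A]
    [Algebra k A] {f : ι → A} (hf : OrthogonalIdempotents f) :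
    Module.finrank k (Submodule.span k (Set.range f)) = {i | f i ≠ 0}.ncard := by
  have := Fintype.ofFinite {i | f i ≠ 0}
  have hrange : Set.range (fun i : {i | f i ≠ 0} => f i) = Set.range f \ {0} := by
    ext x
    constructor
    · rintro ⟨i, rfl⟩
      exact ⟨Set.mem_range_self _, i.2⟩
    · rintro ⟨⟨i, rfl⟩, hi⟩
      exact ⟨⟨i, hi⟩, rfl⟩
  rw [← Submodule.span_sdiff_singleton_zero, ← hrange,
    finrank_span_eq_card (linearIndependent_ne_zero_of_orthogonalIdempotents hf),
    ← Nat.card_eq_fintype_card, Nat.card_coe_set_eq]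

section Partition

variable {ι X : Type*} {B : ι → Set X}

theorem isPartition_range_diff_empty (hB : ∀ x, ∃! i, x ∈ B i) :
    Setoid.IsPartition (Set.range B \ {∅}) := by
  refine ⟨fun h => h.2 rfl, fun x => ?_⟩
  obtain ⟨i, hi, huniq⟩ := hB x
  refine ⟨B i, ⟨⟨⟨i, rfl⟩, Set.Nonempty.ne_empty ⟨x, hi⟩⟩, hi⟩, ?_⟩
  rintro _ ⟨⟨⟨j, rfl⟩, -⟩, hj⟩
  rw [huniq j hj]

theorem encard_range_diff_empty (hB : ∀ x, ∃! i, x ∈ B i) :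
    (Set.range B \ {∅}).encard = {i | (B i).Nonempty}.encard := by
  have himage : Set.range B \ {∅} = B '' {i | (B i).Nonempty} := by
    ext C
    constructor
    · rintro ⟨⟨i, rfl⟩, hi⟩
      exact ⟨i, Set.nonempty_iff_ne_empty.mpr hi, rfl⟩
    · rintro ⟨i, hi, rfl⟩
      exact ⟨⟨i, rfl⟩, hi.ne_empty⟩
  have hinj : Set.InjOn B {i | (B i).Nonempty} := by
    rintro i ⟨x, hx⟩ j - hij
    exact (hB x).unique hx (hij ▸ hx)
  rw [himage, hinj.encard_image]

end Partition

section SubgroupAverage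

open MonoidAlgebra (single)

theorem natCast_card_subgroup_ne_zero {k G : Type*} [Semiring k] [Group G]
    [NeZero (Nat.card G : k)] (H : Subgroup G) : (Nat.card H : k) ≠ 0 :=
  ne_zero_of_dvd_ne_zero (NeZero.ne (Nat.card G : k)) (Nat.cast_dvd_cast H.card_subgroup_dvd_card)

variable {k G : Type*} [Field k] [Group G] [Finite G]

/-- The element `|H|⁻¹ ∑_{h ∈ H} h` of the group algebra, for a subgroup `H`. -/
noncomputable def subgroupAverage (k : Type*) [Field k] (H : Subgroup G) : MonoidAlgebra k G :=
  (Nat.card H : k)⁻¹ • ∑ h ∈ (Set.toFinite (H : Set G)).toFinset, single h 1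

open Classical in
theorem coeff_subgroupAverage (H : Subgroup G) (g : G) :
    (subgroupAverage k H).coeff g = if g ∈ H then (Nat.card H : k)⁻¹ else 0 := by
  simp [subgroupAverage, Finsupp.single_apply]

theorem subgroupAverage_bot : subgroupAverage k (⊥ : Subgroup G) = 1 := by
  simp [subgroupAverage, MonoidAlgebra.one_def, ← Finset.singleton_one]

theorem single_mul_subgroupAverage {H : Subgroup G} {g : G} (hg : g ∈ H) :
    single g 1 * subgroupAverage k H = subgroupAverage k H := by
  classical
  ext h
  rw [MonoidAlgebra.coeff_single_mul_apply, coeff_subgroupAverage, coeff_subgroupAverage,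
    Subgroup.mul_mem_cancel_left H (H.inv_mem hg), one_mul]

theorem subgroupAverage_mem_center (H : Subgroup G) [hH : H.Normal] :
    subgroupAverage k H ∈ Subalgebra.center k (MonoidAlgebra k G) := by
  classical
  rw [Subalgebra.mem_center_iff]
  intro y
  induction y using MonoidAlgebra.induction_on with
  | of g =>
    ext h
    rw [MonoidAlgebra.of_apply, MonoidAlgebra.coeff_single_mul_apply,
      MonoidAlgebra.coeff_mul_single_apply, coeff_subgroupAverage, coeff_subgroupAverage,
      hH.mem_comm_iff, one_mul, mul_one]
  | add y z hy hz => rw [add_mul, mul_add, hy, hz]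
  | smul r y hy => rw [smul_mul_assoc, mul_smul_comm, hy]

variable [NeZero (Nat.card G : k)]

theorem subgroupAverage_mul_of_forall_single_mul_eq {H : Subgroup G} {x : MonoidAlgebra k G}
    (hx : ∀ h ∈ H, single h 1 * x = x) : subgroupAverage k H * x = x := by
  rw [subgroupAverage, smul_mul_assoc, Finset.sum_mul,
    Finset.sum_congr rfl fun h hh => hx h ((Set.toFinite _).mem_toFinset.mp hh), Finset.sum_const,
    ← Set.ncard_eq_toFinset_card, ← Nat.card_coe_set_eq, ← Nat.cast_smul_eq_nsmul k,
    SetLike.coe_sort_coe, inv_smul_smul₀ (natCast_card_subgroup_ne_zero H)]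

theorem subgroupAverage_sup (H K : Subgroup G) [H.Normal] [K.Normal] :
    subgroupAverage k (H ⊔ K) = subgroupAverage k H * subgroupAverage k K := by
  have hcentral (L : Subgroup G) [L.Normal] (x : MonoidAlgebra k G) :
      x * subgroupAverage k L = subgroupAverage k L * x :=
    Subalgebra.mem_center_iff.mp (subgroupAverage_mem_center L) x
  have hfixed : ∀ g ∈ H ⊔ K, single g 1 * (subgroupAverage k H * subgroupAverage k K) =
      subgroupAverage k H * subgroupAverage k K := by
    intro g hg
    rw [← SetLike.mem_coe, Subgroup.mul_normal] at hg
    obtain ⟨h, hh, x, hx, rfl⟩ := hg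
    calc single (h * x) 1 * (subgroupAverage k H * subgroupAverage k K)
        = single h 1 * (single x 1 * (subgroupAverage k K * subgroupAverage k H)) := by
          rw [← hcentral H, ← mul_assoc (single h 1), MonoidAlgebra.single_mul_single, one_mul]
      _ = single h 1 * subgroupAverage k H * subgroupAverage k K := by
          rw [← mul_assoc (single x 1), single_mul_subgroupAverage hx, hcentral H, mul_assoc]
      _ = subgroupAverage k H * subgroupAverage k K := by rw [single_mul_subgroupAverage hh]
  have habsorb {L : Subgroup G} (hL : L ≤ H ⊔ K) :
      subgroupAverage k L * subgroupAverage k (H ⊔ K) = subgroupAverage k (H ⊔ K) :=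
    subgroupAverage_mul_of_forall_single_mul_eq fun l hl => single_mul_subgroupAverage (hL hl)
  calc subgroupAverage k (H ⊔ K)
      = subgroupAverage k H * subgroupAverage k K * subgroupAverage k (H ⊔ K) := by
        rw [mul_assoc, habsorb le_sup_right, habsorb le_sup_left]
    _ = subgroupAverage k H * subgroupAverage k K := by
        rw [hcentral (H ⊔ K), subgroupAverage_mul_of_forall_single_mul_eq hfixed]

/-- `subgroupAverage` of a normal subgroup, as an element of the center of the group algebra. -/
noncomputable def centralAverage (k : Type*) [Field k] (H : Subgroup G) [H.Normal] :
    Subalgebra.center k (MonoidAlgebra k G) :=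
  ⟨subgroupAverage k H, subgroupAverage_mem_center H⟩

/-- Coefficients of central elements of the group algebra. -/
noncomputable def centerCoeff (k G : Type*) [Field k] [Group G] :
    Subalgebra.center k (MonoidAlgebra k G) →ₗ[k] G → k :=
  Finsupp.lcoeFun ∘ₗ (MonoidAlgebra.coeffLinearEquiv k).toLinearMap ∘ₗ
    (Subalgebra.center k (MonoidAlgebra k G)).val.toLinearMap

theorem centerCoeff_injective (k G : Type*) [Field k] [Group G] :
    Function.Injective (centerCoeff k G) :=
  DFunLike.coe_injective.comp <| (MonoidAlgebra.coeffLinearEquiv k).injective.comp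
    Subtype.val_injective

end SubgroupAverage

section Circ

variable {G : Type*} [Group G] {A : Sublattice (Subgroup G)}

theorem mem_circ_iff {H : A} {g : G} :
    g ∈ circ (A : Set (Subgroup G)) H ↔ g ∈ (H : Subgroup G) ∧ ∀ K < H, g ∉ (K : Subgroup G) := by
  simp only [circ, Set.mem_sdiff, SetLike.mem_coe, Set.mem_iUnion, Set.mem_ofPred_eq, not_exists,
    and_imp]
  exact and_congr_right fun _ => ⟨fun h K hK => h K K.2 hK, fun h K hA hK => h ⟨K, hA⟩ hK⟩

theorem mem_iff_le_of_mem_circ {H K : A} {g : G} (hg : g ∈ circ (A : Set (Subgroup G)) H) :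
    g ∈ (K : Subgroup G) ↔ H ≤ K := by
  obtain ⟨hgH, hmin⟩ := mem_circ_iff.mp hg
  refine ⟨fun hgK => ?_, fun hHK => hHK hgH⟩
  by_contra hHK
  exact hmin (H ⊓ K) (inf_lt_left.mpr hHK) ⟨hgH, hgK⟩

theorem existsUnique_mem_circ [Finite A] (htop : ⊤ ∈ A) (g : G) :
    ∃! H : A, g ∈ circ (A : Set (Subgroup G)) H := by
  obtain ⟨H, hgH, hmin⟩ := exists_minimal_of_wellFoundedLT (fun H : A => g ∈ (H : Subgroup G))
    ⟨⟨⊤, htop⟩, Subgroup.mem_top g⟩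
  refine ⟨H, mem_circ_iff.mpr ⟨hgH, fun K hK hgK => hK.not_ge (hmin hgK hK.le)⟩, fun K hK => ?_⟩
  have hKH : K ≤ H := (mem_iff_le_of_mem_circ hK).mp hgH
  exact hKH.antisymm (hmin (mem_circ_iff.mp hK).1 hKH)

/-- The indicator function of a member of `A`. The index runs over the order dual of `A`, in which
the join is the intersection, so that joins become products. -/
noncomputable def memberIndicator (k : Type*) [Zero k] [One k] (H : Aᵒᵈ) : G → k :=
  ((OrderDual.ofDual H : A) : Set G).indicator 1

theorem memberIndicator_sup (k : Type*) [MulZeroOneClass k] (H K : Aᵒᵈ) :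
    memberIndicator k (H ⊔ K) = memberIndicator k H * memberIndicator k K :=
  Set.inter_indicator_one

theorem memberIndicator_top (k : Type*) [Zero k] [One k] (htop : ⊤ ∈ A) :
    memberIndicator k (OrderDual.toDual (⟨⊤, htop⟩ : A)) = 1 :=
  Set.indicator_univ 1

theorem strictPart_memberIndicator [Fintype A] (k : Type*) [CommRing k] (H : Aᵒᵈ) :
    strictPart (memberIndicator k) H =
      (circ (A : Set (Subgroup G)) (OrderDual.ofDual H : A)).indicator 1 := by
  classical
  ext g
  simp only [strictPart, memberIndicator, Pi.mul_apply, Finset.prod_apply, Pi.sub_apply,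
    Pi.one_apply]
  by_cases hg : g ∈ circ (A : Set (Subgroup G)) (OrderDual.ofDual H : A)
  · obtain ⟨hgH, hmin⟩ := mem_circ_iff.mp hg
    rw [Set.indicator_of_mem hg, Set.indicator_of_mem hgH, Pi.one_apply, one_mul]
    refine Finset.prod_eq_one fun K hK => ?_
    rw [Set.indicator_of_notMem (hmin (OrderDual.ofDual K) (Finset.mem_filter.mp hK).2), sub_zero]
  · rw [Set.indicator_of_notMem hg]
    by_cases hgH : g ∈ (OrderDual.ofDual H : A).1
    · obtain ⟨K, hKH, hgK⟩ : ∃ K < OrderDual.ofDual H, g ∈ (K : Subgroup G) := by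
        simpa [mem_circ_iff, hgH] using hg
      have hmem : OrderDual.toDual K ∈ Finset.univ.filter (H < ·) := by
        simpa [OrderDual.lt_toDual] using hKH
      rw [Finset.prod_eq_zero hmem (by simp [hgK]), mul_zero]
    · rw [Set.indicator_of_notMem hgH, zero_mul]

theorem coeff_subgroupAverage_inv_eq_of_mem_circ [Finite G] (k : Type*) [Field k] {H : A} (K : A)
    {g h : G} (hg : g ∈ circ (A : Set (Subgroup G)) H) (hh : h ∈ circ (A : Set (Subgroup G)) H) :
    (subgroupAverage k (K : Subgroup G)).coeff g⁻¹ =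
      (subgroupAverage k (K : Subgroup G)).coeff h⁻¹ := by
  classical
  have hiff : g⁻¹ ∈ (K : Subgroup G) ↔ h⁻¹ ∈ (K : Subgroup G) := by
    rw [inv_mem_iff, inv_mem_iff, mem_iff_le_of_mem_circ hg, mem_iff_le_of_mem_circ hh]
  rw [coeff_subgroupAverage, coeff_subgroupAverage, if_congr hiff rfl rfl]

end Circ

section LinearExtension

variable {k G : Type*} [Field k]

/-- The linear extension of a function on `G` to the group algebra. -/
noncomputable def linearExtension (ψ : G → k) : MonoidAlgebra k G →ₗ[k] k :=
  (MonoidAlgebra.basis G k).constr k ψ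

theorem linearExtension_add (ψ θ : G → k) :
    linearExtension (ψ + θ) = linearExtension ψ + linearExtension θ :=
  map_add ((MonoidAlgebra.basis G k).constr k) ψ θ

theorem linearExtension_eq {ψ : G → k} {φ : MonoidAlgebra k G →ₗ[k] k}
    (hφ : ∀ g, φ (MonoidAlgebra.single g 1) = ψ g) : linearExtension ψ = φ :=
  (MonoidAlgebra.basis G k).constr_eq k fun g => by simp [hφ]

variable {V : Type*} [Monoid G] [AddCommGroup V] [Module k V]

theorem linearExtension_character (ρ : Representation k G V) (x : MonoidAlgebra k G) :
    linearExtension ρ.character x = LinearMap.trace k V (ρ.asAlgebraHom x) :=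
  LinearMap.congr_fun
    (linearExtension_eq (φ := LinearMap.trace k V ∘ₗ ρ.asAlgebraHom.toLinearMap) fun g => by
      simp [Representation.character]) x

variable [FiniteDimensional k V] (ρ : Representation k G V) {x : MonoidAlgebra k G}

theorem linearExtension_character_mem_range_natCast (hx : IsIdempotentElem x) :
    linearExtension ρ.character x ∈ Set.range ((↑) : ℕ → k) := by
  rw [linearExtension_character]
  have hproj := LinearMap.IsIdempotentElem.isProj_range _ (hx.map ρ.asAlgebraHom)
  exact ⟨_, hproj.trace.symm⟩

theorem linearExtension_character_eq_zero_iff [CharZero k] (hx : IsIdempotentElem x) :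
    linearExtension ρ.character x = 0 ↔ ρ.asAlgebraHom x = 0 := by
  rw [linearExtension_character,
    LinearMap.IsIdempotentElem.trace_eq_zero_iff (hx.map ρ.asAlgebraHom)]

end LinearExtension

section Representation

variable {k G V : Type*} [Field k] [Monoid G] [AddCommGroup V] [Module k V]

theorem asAlgebraHom_eq_zero_or_eq_zero {ρ : Representation k G V} [ρ.IsIrreducible]
    {x y : MonoidAlgebra k G} (hx : x ∈ Subalgebra.center k (MonoidAlgebra k G))
    (hxy : x * y = 0) : ρ.asAlgebraHom x = 0 ∨ ρ.asAlgebraHom y = 0 := by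
  let φ : ρ.IntertwiningMap ρ := Representation.IntertwiningMap.centralAlgebraMul ρ hx
  rcases Representation.IsIrreducible.injective_or_eq_zero φ with hinj | hzero
  · right
    ext v
    refine hinj ?_
    change ρ.asAlgebraHom x (ρ.asAlgebraHom y v) = φ 0
    rw [← Module.End.mul_apply, ← map_mul, hxy, map_zero, map_zero]
    rfl
  · left
    ext v
    exact congrArg (fun f : ρ.IntertwiningMap ρ => f v) hzero

theorem isIrreducible_of_equiv {W : Type*} [AddCommGroup W] [Module k W]
    {ρ : Representation k G V} {σ : Representation k G W} (φ : ρ.Equiv σ) [ρ.IsIrreducible] :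
    σ.IsIrreducible := by
  rw [Representation.irreducible_iff_isSimpleModule_asModule]
  let ψ := Representation.IntertwiningMap.equivLinearMapAsModule ρ σ φ.toIntertwiningMap
  have hψ : Function.Bijective ψ := φ.toLinearEquiv.bijective
  exact IsSimpleModule.congr (LinearEquiv.ofBijective ψ hψ).symm

theorem asAlgebraHom_ofModule'_apply {M : Type*} [AddCommMonoid M] [Module k M]
    [Module (MonoidAlgebra k G) M] [IsScalarTower k (MonoidAlgebra k G) M]
    (x : MonoidAlgebra k G) (m : M) :
    (Representation.ofModule' (k := k) (G := G) M).asAlgebraHom x m = x • m := by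
  simp [Representation.asAlgebraHom, Representation.ofModule']

theorem isIrreducible_ofModule' (M : Type*) [AddCommGroup M] [Module k M]
    [Module (MonoidAlgebra k G) M] [IsScalarTower k (MonoidAlgebra k G) M]
    [IsSimpleModule (MonoidAlgebra k G) M] :
    (Representation.ofModule' (k := k) (G := G) M).IsIrreducible := by
  let ρ := Representation.ofModule' (k := k) (G := G) M
  rw [Representation.irreducible_iff_isSimpleModule_asModule]
  let e : ρ.asModule ≃ₗ[MonoidAlgebra k G] M :=
    { ρ.asModuleEquiv with
      map_smul' := fun x m => (ρ.asModuleEquiv_map_smul x m).trans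
        (asAlgebraHom_ofModule'_apply x _) }
  exact IsSimpleModule.congr e

theorem exists_equiv_pi [FiniteDimensional k V] (ρ : Representation k G V) :
    ∃ (n : ℕ) (σ : Representation k G (Fin n → k)), Nonempty (ρ.Equiv σ) := by
  let e := (Module.finBasis k V).equivFun
  exact ⟨_, (e.conjRingEquiv : Module.End k V →* _).comp ρ,
    ⟨Representation.Equiv.mk e fun g => by ext; simp⟩⟩

end Representation

theorem exists_isMaximal_notMem {R : Type*} [Ring R] [IsSemisimpleRing R] {x : R} (hx : x ≠ 0) :
    ∃ I : Ideal R, I.IsMaximal ∧ x ∉ I := by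
  by_contra! h
  have : x ∈ Ring.jacobson R := by
    rw [Ring.jacobson_eq_sInf_isMaximal]
    simpa [Submodule.mem_sInf] using h
  rw [IsSemisimpleRing.jacobson_eq_bot] at this
  exact hx this

section Irr

variable {G V : Type*} [Group G] [AddCommGroup V] [Module ℂ V] [FiniteDimensional ℂ V]

theorem isCharacter_character (ρ : Representation ℂ G V) : IsCharacter ρ.character := by
  obtain ⟨n, σ, ⟨φ⟩⟩ := exists_equiv_pi ρ
  exact ⟨n, σ, Representation.char_iso φ⟩

theorem character_mem_Irr (ρ : Representation ℂ G V) [ρ.IsIrreducible] :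
    ρ.character ∈ Irr G := by
  obtain ⟨n, σ, ⟨φ⟩⟩ := exists_equiv_pi ρ
  exact ⟨n, σ, isIrreducible_of_equiv φ, Representation.char_iso φ⟩

theorem exists_irr_linearExtension_ne_zero_of_smul_ne_zero [Finite G] {x : MonoidAlgebra ℂ G}
    (hi : IsIdempotentElem x) {M : Type*} [AddCommGroup M] [Module ℂ M]
    [Module (MonoidAlgebra ℂ G) M] [IsScalarTower ℂ (MonoidAlgebra ℂ G) M]
    [IsSimpleModule (MonoidAlgebra ℂ G) M] {m : M} (hm : x • m ≠ 0) :
    ∃ χ : Irr G, linearExtension χ.1 x ≠ 0 := by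
  have : FiniteDimensional ℂ M := Module.Finite.trans (MonoidAlgebra ℂ G) M
  have := isIrreducible_ofModule' (k := ℂ) (G := G) M
  refine ⟨⟨_, character_mem_Irr (.ofModule' M)⟩, ?_⟩
  rw [Ne, linearExtension_character_eq_zero_iff _ hi]
  intro hzero
  rw [← asAlgebraHom_ofModule'_apply (k := ℂ), hzero] at hm
  exact hm rfl

theorem exists_irr_linearExtension_ne_zero [Finite G] {x : MonoidAlgebra ℂ G}
    (hi : IsIdempotentElem x) (hx : x ≠ 0) : ∃ χ : Irr G, linearExtension χ.1 x ≠ 0 := by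
  obtain ⟨I, hI, hxI⟩ := exists_isMaximal_notMem hx
  have : IsSimpleModule (MonoidAlgebra ℂ G) (MonoidAlgebra ℂ G ⧸ I) :=
    isSimpleModule_iff_isCoatom.mpr hI.out
  refine exists_irr_linearExtension_ne_zero_of_smul_ne_zero hi
    (m := (Submodule.Quotient.mk 1 : MonoidAlgebra ℂ G ⧸ I)) ?_
  rwa [← Submodule.Quotient.mk_smul, smul_eq_mul, mul_one, Ne, Submodule.Quotient.mk_eq_zero]

theorem linearExtension_eq_zero_of_isConstituent {χ : Irr G} {ψ : G → ℂ} (hψ : IsConstituent χ ψ)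
    {x : MonoidAlgebra ℂ G} (hi : IsIdempotentElem x) (hx : linearExtension ψ x = 0) :
    linearExtension χ.1 x = 0 := by
  obtain ⟨θ, ⟨n, σ, rfl⟩, rfl⟩ := hψ
  obtain ⟨m, ρ, -, hχ⟩ := χ.2
  obtain ⟨a, ha⟩ := linearExtension_character_mem_range_natCast ρ hi
  obtain ⟨b, hb⟩ := linearExtension_character_mem_range_natCast σ hi
  rw [linearExtension_add, LinearMap.add_apply, hχ, ← ha, ← hb, ← Nat.cast_add,
    Nat.cast_eq_zero, add_eq_zero] at hx
  rw [hχ, ← ha, hx.1, Nat.cast_zero]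

end Irr

section BlockCharacter

theorem trace_asAlgebraHom_leftRegular {k G : Type*} [CommRing k] [Group G] [Finite G]
    (x : MonoidAlgebra k G) :
    LinearMap.trace k _ ((Representation.leftRegular k G).asAlgebraHom x) =
      Nat.card G * x.coeff 1 := by
  classical
  have := Fintype.ofFinite G
  have hrepr (y : MonoidAlgebra k G) (g : G) : (MonoidAlgebra.basis G k).repr y g = y.coeff g := rfl
  rw [LinearMap.trace_eq_matrix_trace k (MonoidAlgebra.basis G k), Matrix.trace]
  simp [LinearMap.toMatrix_apply, hrepr, MonoidAlgebra.coeff_mul_single_apply]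

variable {k G : Type*} [Field k] [Group G]

/-- The function `g ↦ |G| x_{g⁻¹}` on `G`. For a central idempotent `x` it is the character of the
ideal of the group algebra generated by `x`. -/
noncomputable def blockCharacter (x : MonoidAlgebra k G) (g : G) : k :=
  Nat.card G * x.coeff g⁻¹

theorem isCharacter_blockCharacter [Finite G] {x : MonoidAlgebra ℂ G}
    (hx : x ∈ Subalgebra.center ℂ (MonoidAlgebra ℂ G)) (hi : IsIdempotentElem x) :
    IsCharacter (blockCharacter x) := by
  let ρ := Representation.leftRegular ℂ G
  let U := (Representation.IntertwiningMap.centralAlgebraMul ρ hx).range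
  suffices h : blockCharacter x = U.toRepresentation.character from
    h ▸ isCharacter_character U.toRepresentation
  funext g
  have hmem (v) : ρ.asAlgebraHom (MonoidAlgebra.single g 1 * x) v ∈ U.toSubmodule := by
    rw [Subalgebra.mem_center_iff.mp hx, map_mul]
    exact ⟨_, rfl⟩
  have hfixed {v} (hv : v ∈ U.toSubmodule) : ρ.asAlgebraHom x v = v := by
    obtain ⟨w, rfl⟩ := hv
    change ρ.asAlgebraHom x (ρ.asAlgebraHom x w) = ρ.asAlgebraHom x w
    rw [← Module.End.mul_apply, ← map_mul, hi.eq]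
  have hrestrict : (ρ.asAlgebraHom (MonoidAlgebra.single g 1 * x)).restrict (fun v _ => hmem v) =
      U.toRepresentation g := by
    ext v : 2
    change ρ.asAlgebraHom (MonoidAlgebra.single g 1 * x) v.1 = ρ g v.1
    rw [map_mul, Representation.asAlgebraHom_single_one, Module.End.mul_apply, hfixed v.2]
  rw [Representation.character, ← hrestrict, LinearMap.trace_restrict_eq_of_forall_mem _ _ hmem,
    trace_asAlgebraHom_leftRegular, MonoidAlgebra.coeff_single_mul_apply, one_mul, mul_one,
    blockCharacter]

theorem linearExtension_blockCharacter (x y : MonoidAlgebra k G) :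
    linearExtension (blockCharacter x) y = Nat.card G * (y * x).coeff 1 := by
  let φ : MonoidAlgebra k G →ₗ[k] k :=
    (Nat.card G : k) • (MonoidAlgebra.basis G k).coord 1 ∘ₗ LinearMap.mulRight k x
  exact LinearMap.congr_fun (linearExtension_eq (φ := φ) fun g => by
    change (Nat.card G : k) * (MonoidAlgebra.single g 1 * x).coeff 1 = _
    simp [blockCharacter, MonoidAlgebra.coeff_single_mul_apply]) y

theorem blockCharacter_ne_zero [NeZero (Nat.card G : k)] {x : MonoidAlgebra k G}
    (hx : x ≠ 0) : blockCharacter x ≠ 0 := by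
  contrapose! hx
  ext g
  simpa [blockCharacter, NeZero.ne (Nat.card G : k)] using congrFun hx g⁻¹

end BlockCharacter

section IrrBlock

variable {G : Type*} [Group G]

/-- The irreducible characters that do not vanish on `x`. For a central idempotent `x` these are the
ones of the irreducible representations on which `x` acts as the identity. -/
def irrBlock (x : MonoidAlgebra ℂ G) : Set (Irr G) :=
  {χ | linearExtension χ.1 x ≠ 0}

theorem irrBlock_nonempty_iff [Finite G] {x : MonoidAlgebra ℂ G} (hi : IsIdempotentElem x) :
    (irrBlock x).Nonempty ↔ x ≠ 0 := by
  refine ⟨?_, exists_irr_linearExtension_ne_zero hi⟩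
  rintro ⟨χ, hχ⟩ rfl
  exact hχ (map_zero _)

variable {ι : Type*} [Fintype ι] {f : ι → Subalgebra.center ℂ (MonoidAlgebra ℂ G)}

theorem existsUnique_mem_irrBlock (hf : CompleteOrthogonalIdempotents f) (χ : Irr G) :
    ∃! i, χ ∈ irrBlock (f i : MonoidAlgebra ℂ G) := by
  obtain ⟨n, ρ, hρ, hχ⟩ := χ.2
  have hmem (i : ι) : χ ∈ irrBlock (f i : MonoidAlgebra ℂ G) ↔ ρ.asAlgebraHom (f i) ≠ 0 := by
    rw [irrBlock, Set.mem_ofPred_eq, hχ, Ne, linearExtension_character_eq_zero_iff]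
    exact (hf.idem i).map (Subalgebra.center ℂ (MonoidAlgebra ℂ G)).subtype
  simp only [hmem]
  have hsum : ∑ i, ρ.asAlgebraHom (f i) = 1 := by
    rw [← map_sum, ← AddSubmonoidClass.coe_finsetSum, hf.complete, OneMemClass.coe_one, map_one]
  have : Nontrivial (Fin n → ℂ) := IsSimpleModule.nontrivial (MonoidAlgebra ℂ G) ρ.asModule
  obtain ⟨i, -, hi⟩ := Finset.exists_ne_zero_of_sum_ne_zero (hsum ▸ one_ne_zero)
  refine ⟨i, hi, fun j hj => ?_⟩
  by_contra hji
  have horth : (f j : MonoidAlgebra ℂ G) * f i = 0 := congrArg Subtype.val (hf.ortho hji)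
  exact (asAlgebraHom_eq_zero_or_eq_zero (f j).2 horth).elim hj hi

theorem isSuperclassTheory_of_completeOrthogonalIdempotents [Finite G]
    (hf : CompleteOrthogonalIdempotents f) {𝒦 : Set (Set G)} (hpart : Setoid.IsPartition 𝒦)
    (hcard : 𝒦.encard = {i | f i ≠ 0}.encard)
    (hconst : ∀ i, ∀ C ∈ 𝒦, ∀ g ∈ C, ∀ h ∈ C,
      (f i : MonoidAlgebra ℂ G).coeff g⁻¹ = (f i : MonoidAlgebra ℂ G).coeff h⁻¹)
    (hone : {1} ∈ 𝒦) : IsSuperclassTheory 𝒦 := by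
  have hidem (i : ι) : IsIdempotentElem (f i : MonoidAlgebra ℂ G) :=
    (hf.idem i).map (Subalgebra.center ℂ (MonoidAlgebra ℂ G)).subtype
  have hblock := existsUnique_mem_irrBlock hf
  have hnonempty (i : ι) : (irrBlock (f i : MonoidAlgebra ℂ G)).Nonempty ↔ f i ≠ 0 := by
    rw [irrBlock_nonempty_iff (hidem i), Ne, ZeroMemClass.coe_eq_zero]
  refine ⟨Set.range (fun i => irrBlock (f i : MonoidAlgebra ℂ G)) \ {∅},
    isPartition_range_diff_empty hblock, hpart, ?_, ?_, hone⟩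
  · simp only [hcard, encard_range_diff_empty hblock, hnonempty]
  · rintro _ ⟨⟨i, rfl⟩, hi⟩
    have hfi : (f i : MonoidAlgebra ℂ G) ≠ 0 :=
      (irrBlock_nonempty_iff (hidem i)).mp (Set.nonempty_iff_ne_empty.mpr hi)
    refine ⟨blockCharacter (f i), isCharacter_blockCharacter (f i).2 (hidem i),
      blockCharacter_ne_zero hfi, fun χ hχ => ?_, fun C hC g hg h hh => by
        rw [blockCharacter, blockCharacter, hconst i C hC g hg h hh]⟩
    obtain ⟨j, hj, -⟩ := hblock χ
    obtain rfl | hji := eq_or_ne j i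
    · exact hj
    · have horth : (f j : MonoidAlgebra ℂ G) * f i = 0 := congrArg Subtype.val (hf.ortho hji)
      refine absurd (linearExtension_eq_zero_of_isConstituent hχ (hidem j) ?_) hj
      rw [linearExtension_blockCharacter, horth, MonoidAlgebra.coeff_zero, Finsupp.zero_apply,
        mul_zero]

end IrrBlock

section NormalLattice

variable {G : Type*} [Group G] [Finite G] {A : Sublattice (Subgroup G)}
  [∀ H : A, (H : Subgroup G).Normal]

theorem centralAverage_sup (k : Type*) [Field k] [NeZero (Nat.card G : k)] (H K : A) :
    centralAverage k ((H ⊔ K : A) : Subgroup G) = centralAverage k H.1 * centralAverage k K.1 :=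
  Subtype.ext (subgroupAverage_sup H.1 K.1)

theorem one_mem_range_centralAverage (k : Type*) [Field k] (hbot : ⊥ ∈ A) :
    1 ∈ Set.range fun H : A => centralAverage k H.1 :=
  ⟨⟨⊥, hbot⟩, Subtype.ext subgroupAverage_bot⟩

theorem memberIndicator_eq_smul_centerCoeff (k : Type*) [Field k] [NeZero (Nat.card G : k)]
    (H : A) : memberIndicator k (OrderDual.toDual H) =
      (Nat.card (H : Subgroup G) : k) • centerCoeff k G (centralAverage k H.1) := by
  ext g
  change _ = (Nat.card (H : Subgroup G) : k) • (subgroupAverage k (H : Subgroup G)).coeff g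
  by_cases hg : g ∈ (H : Subgroup G) <;>
    simp [memberIndicator, coeff_subgroupAverage, hg, natCast_card_subgroup_ne_zero]

theorem map_span_range_centralAverage (k : Type*) [Field k] [NeZero (Nat.card G : k)] :
    (Submodule.span k (Set.range fun H : A => centralAverage k H.1)).map (centerCoeff k G) =
      Submodule.span k (Set.range (memberIndicator (A := A) k)) := by
  have hunit (H : A) : IsUnit (Nat.card (H : Subgroup G) : k) :=
    (natCast_card_subgroup_ne_zero H.1).isUnit
  rw [Submodule.map_span, ← Set.range_comp, ← OrderDual.toDual.surjective.range_comp,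
    Submodule.span_range_eq_iSup, Submodule.span_range_eq_iSup]
  simp only [Function.comp_apply, memberIndicator_eq_smul_centerCoeff,
    Submodule.span_singleton_smul_eq (hunit _)]

theorem ncard_strictPart_centralAverage_ne_zero (k : Type*) [Field k] [NeZero (Nat.card G : k)]
    [Fintype A] (hbot : ⊥ ∈ A) (htop : ⊤ ∈ A) :
    {H : A | strictPart (fun K : A => centralAverage k K.1) H ≠ 0}.ncard =
      {H : A | (circ (A : Set (Subgroup G)) H).Nonempty}.ncard := by
  have hsup := centralAverage_sup (A := A) k
  have hone := one_mem_range_centralAverage k hbot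
  have hsup' := memberIndicator_sup (A := A) k
  have hone' : 1 ∈ Set.range (memberIndicator (A := A) k) := ⟨_, memberIndicator_top k htop⟩
  have hcirc : {H : A | (circ (A : Set (Subgroup G)) H).Nonempty} =
      OrderDual.toDual ⁻¹' {H | strictPart (memberIndicator (A := A) k) H ≠ 0} := by
    ext H
    simp [strictPart_memberIndicator, Set.nonempty_iff_ne_empty]
  rw [hcirc, Set.ncard_preimage_of_injective_subset_range OrderDual.toDual.injective (by simp),
    ← finrank_span_range_of_orthogonalIdempotents (k := k) (orthogonalIdempotents_strictPart hsup),
    ← finrank_span_range_of_orthogonalIdempotents (k := k) (orthogonalIdempotents_strictPart hsup'),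
    span_range_strictPart k hsup hone, span_range_strictPart k hsup' hone',
    ← map_span_range_centralAverage]
  exact (Submodule.equivMapOfInjective _ (centerCoeff_injective k G) _).finrank_eq

theorem centerCoeff_inv_eq_of_mem_circ {k : Type*} [Field k]
    {z : Subalgebra.center k (MonoidAlgebra k G)}
    (hz : z ∈ Submodule.span k (Set.range fun K : A => centralAverage k K.1)) {H : A} {g h : G}
    (hg : g ∈ circ (A : Set (Subgroup G)) H) (hh : h ∈ circ (A : Set (Subgroup G)) H) :
    centerCoeff k G z g⁻¹ = centerCoeff k G z h⁻¹ := by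
  have hle : Submodule.span k (Set.range fun K : A => centralAverage k K.1) ≤
      LinearMap.eqLocus (LinearMap.proj g⁻¹ ∘ₗ centerCoeff k G)
        (LinearMap.proj h⁻¹ ∘ₗ centerCoeff k G) := by
    rw [Submodule.span_le]
    rintro _ ⟨K, rfl⟩
    exact coeff_subgroupAverage_inv_eq_of_mem_circ k K hg hh
  exact hle hz

theorem isSuperclassTheory_circ (hbot : ⊥ ∈ A) (htop : ⊤ ∈ A) :
    IsSuperclassTheory {C : Set G | C.Nonempty ∧
      ∃ H ∈ (A : Set (Subgroup G)), C = circ (A : Set (Subgroup G)) H} := by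
  have := Fintype.ofFinite A
  have hsup := centralAverage_sup (A := A) ℂ
  have hone := one_mem_range_centralAverage ℂ hbot
  have hcirc := existsUnique_mem_circ htop
  have hclasses : {C : Set G | C.Nonempty ∧
      ∃ H ∈ (A : Set (Subgroup G)), C = circ (A : Set (Subgroup G)) H} =
      Set.range (fun H : A => circ (A : Set (Subgroup G)) H) \ {∅} := by
    ext C
    simp [Set.nonempty_iff_ne_empty, and_comm, eq_comm]
  rw [hclasses]
  refine isSuperclassTheory_of_completeOrthogonalIdempotents
    (completeOrthogonalIdempotents_strictPart hsup hone) (isPartition_range_diff_empty hcirc)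
    ?_ ?_ ?_
  · rw [encard_range_diff_empty hcirc, ← (Set.toFinite _).cast_ncard_eq,
      ← (Set.toFinite _).cast_ncard_eq, ncard_strictPart_centralAverage_ne_zero ℂ hbot htop]
  · rintro H _ ⟨⟨K, rfl⟩, -⟩ g hg h hh
    have hspan : strictPart (fun K : A => centralAverage ℂ K.1) H ∈
        Submodule.span ℂ (Set.range fun K : A => centralAverage ℂ K.1) := by
      rw [← span_range_strictPart ℂ hsup hone]
      exact Submodule.subset_span (Set.mem_range_self H)
    exact centerCoeff_inv_eq_of_mem_circ hspan hg hh
  · exact ⟨⟨⟨⊥, hbot⟩, by simp [circ]⟩, Set.singleton_ne_empty 1⟩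

end NormalLattice

section FamilyA

variable {G : Type*} [Group G]

theorem normal_of_generatedFamily {S : Set (Subgroup G)} (hS : ∀ H ∈ S, H.Normal) {H : Subgroup G}
    (hH : GeneratedFamily S H) : H.Normal := by
  induction hH with
  | bot => infer_instance
  | top => infer_instance
  | of H hHS => exact hS H hHS
  | mul H K L _ _ hL hH hK =>
    rw [← Subgroup.mul_normal, SetLike.coe_set_eq] at hL
    exact hL ▸ inferInstance
  | inter H K _ _ hH hK => infer_instance

/-- The family generated by a set of normal subgroups, as a sublattice of the lattice of
subgroups: products of normal subgroups are joins. -/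
def generatedSublattice {S : Set (Subgroup G)} (hS : ∀ H ∈ S, H.Normal) :
    Sublattice (Subgroup G) where
  carrier := {H | GeneratedFamily S H}
  supClosed' H hH K hK :=
    have := normal_of_generatedFamily hS hK
    .mul H K _ hH hK (Subgroup.mul_normal H K)
  infClosed' H hH K hK := .inter H K hH hK

end FamilyA

end SuperChar

theorem mainTheorem1 {G : Type*} [Group G] [Finite G] {k : ℕ} (N : Fin k → Subgroup G)
    (hN : ∀ i, (N i).Normal) :
    SuperChar.IsSuperclassTheory
      {C : Set G | C.Nonempty ∧
        ∃ H ∈ SuperChar.familyA N, C = SuperChar.circ (SuperChar.familyA N) H} := by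
  have hS : ∀ H ∈ Set.range N, H.Normal := Set.forall_mem_range.mpr hN
  have (H : SuperChar.generatedSublattice hS) : (H : Subgroup G).Normal :=
    SuperChar.normal_of_generatedFamily hS H.2
  exact SuperChar.isSuperclassTheory_circ (A := SuperChar.generatedSublattice hS) .bot .top
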